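/- All graphs are finite, simple and undirected. For a graph $G$, let $\Delta(G)$ denote its maximum degree and let $\rho(G)$ denote its spectral radius, i.e. the largest eigenvalue of its adjacency matrix. Let $k, r \ge 2$ be integers. Then there exists a tree $T$ with $\rho(T) = \sqrt{k}$ and $\Delta(T) = r$ if and only if $\frac{k}{4} + 1 < r \le k$. -/

import Mathlib

/-- The spectral radius `ρ(G)` of a finite simple graph: the largest eigenvalue of its (real)
adjacency matrix. -/
noncomputable def graphSpectralRadius {V : Type*} [Fintype V]
    (G : SimpleGraph V) [DecidableRel G.Adj] : ℝ :=
  sSup {μ : ℝ | Module.End.HasEigenvalue (Matrix.mulVecLin (G.adjMatrix ℝ)) μ}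

/-- On a graph with at least one vertex the supremum above is attained, so that
`graphSpectralRadius G` really is the largest eigenvalue. -/
theorem isGreatest_graphSpectralRadius {V : Type*} [Fintype V] [Nonempty V]
    (G : SimpleGraph V) [DecidableRel G.Adj] :
    IsGreatest {μ : ℝ | Module.End.HasEigenvalue (Matrix.mulVecLin (G.adjMatrix ℝ)) μ}
      (graphSpectralRadius G) := by
  classical
  have hA : (G.adjMatrix ℝ).IsHermitian := by
    rw [Matrix.IsHermitian, Matrix.conjTranspose_eq_transpose_of_trivial]
    exact G.isSymm_adjMatrix
  have heq : {μ : ℝ | Module.End.HasEigenvalue (Matrix.mulVecLin (G.adjMatrix ℝ)) μ} =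
      Set.range hA.eigenvalues := by
    rw [← hA.spectrum_real_eq_range_eigenvalues]
    ext μ
    rw [← Matrix.spectrum_toLin', Set.mem_ofPred_eq, Module.End.hasEigenvalue_iff_mem_spectrum]
    rfl
  unfold graphSpectralRadius
  rw [heq]
  exact (Set.finite_range _).isCompact.isGreatest_sSup (Set.range_nonempty _)

/-! Necessity: the star at a vertex of degree `r` gives `√r ≤ ρ`, and weights decaying like `(r - 1)
^ (-d / 2)` with the distance `d` to a root give `ρ < 2 √(r - 1)`.

Sufficiency: a positive eigenvector forces its eigenvalue to be `ρ`, so it suffices to build a tree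
with a positive eigenvector for `√k`. Grow it from the leaves, recording by `D` how far the
eigenvalue equation fails at the root. A single vertex has `D = k`, hanging a tree with value `D₂`
below a root subtracts `k / D₂` from its value, and `D = 0` closes the tree. All values attached on
the way must be positive.

Write `D = k * X / (2 * (X - 1))`: leaves have `X = 2`, the goal is `X = 0`, and `D > 0` for `X < 0`
or `X > 1`. Two generations, first `m` children of level `X` and `l` leaves, then `n` copies of the
result, act by `X ↦ (n / m) * X + 2` when `2 * m + 2 * n + l = k`. Choices of `m, n` compose to
translations. These raise `X` from `2`; one irregular vertex then sends the level to a negative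
value that is a multiple of a translation length, up to one further affine step, and translations
end exactly at `0`. The residue of `k` mod 4 and the size of `r` decide which translations respect
the degree bound. -/

/-- The sum of `x` over the neighbours of `v`. -/
noncomputable def nbrSum {V : Type*} [Fintype V] (G : SimpleGraph V) (x : V → ℝ) (v : V) : ℝ :=
  open Classical in ∑ w, if G.Adj v w then x w else 0

/-! ### Comparison and variational principles for the largest eigenvalue -/

section Spectral

variable {V : Type*} [Fintype V] (G : SimpleGraph V)

theorem nbrSum_one [DecidableRel G.Adj] (v : V) : nbrSum G 1 v = G.degree v := by
  classical
  simp only [nbrSum, Pi.one_apply, Finset.sum_boole, ← SimpleGraph.card_neighborFinset_eq_degree]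
  congr 2
  ext w
  simp

theorem adjMatrix_mulVec_eq_nbrSum [DecidableRel G.Adj] (x : V → ℝ) :
    (G.adjMatrix ℝ).mulVec x = nbrSum G x := by
  classical
  ext v
  rw [SimpleGraph.adjMatrix_mulVec_apply, nbrSum, SimpleGraph.neighborFinset_eq_filter,
    Finset.sum_filter]
  exact Finset.sum_congr rfl fun w _ => by congr

theorem sum_mul_nbrSum_comm (x y : V → ℝ) :
    ∑ v, x v * nbrSum G y v = ∑ v, y v * nbrSum G x v := by
  classical
  simp only [nbrSum, Finset.mul_sum]
  rw [Finset.sum_comm]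
  refine Finset.sum_congr rfl fun v _ => Finset.sum_congr rfl fun w _ => ?_
  simp only [G.adj_comm w v]
  split_ifs <;> ring

theorem abs_nbrSum_le (x : V → ℝ) (v : V) : |nbrSum G x v| ≤ nbrSum G (fun w => |x w|) v := by
  classical
  unfold nbrSum
  refine (Finset.abs_sum_le_sum_abs _ _).trans (Finset.sum_le_sum fun w _ => ?_)
  split_ifs <;> simp

theorem hasEigenvalue_iff_nbrSum [DecidableRel G.Adj] (μ : ℝ) :
    Module.End.HasEigenvalue (Matrix.mulVecLin (G.adjMatrix ℝ)) μ ↔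
      ∃ x : V → ℝ, x ≠ 0 ∧ ∀ v, nbrSum G x v = μ * x v := by
  constructor
  · intro h
    obtain ⟨x, hx⟩ := h.exists_hasEigenvector
    refine ⟨x, hx.2, fun v => ?_⟩
    have := congrFun hx.apply_eq_smul v
    rwa [Matrix.mulVecLin_apply, adjMatrix_mulVec_eq_nbrSum] at this
  · rintro ⟨x, hx0, hx⟩
    refine Module.End.hasEigenvalue_of_hasEigenvector
      (x := x) ⟨Module.End.mem_eigenspace_iff.2 ?_, hx0⟩
    rw [Matrix.mulVecLin_apply, adjMatrix_mulVec_eq_nbrSum]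
    exact funext hx

/-- Symmetry of the adjacency form moves the neighbour sum from `f` to `|x|`, where the triangle
inequality applies. -/
theorem sum_mul_abs_le_of_eigenvector {μ : ℝ} {x f : V → ℝ} (hf : ∀ v, 0 < f v)
    (hx : ∀ v, nbrSum G x v = μ * x v) :
    μ * ∑ v, f v * |x v| ≤ ∑ v, |x v| * nbrSum G f v := by
  rw [← sum_mul_nbrSum_comm, Finset.mul_sum]
  refine Finset.sum_le_sum fun v _ => ?_
  have h1 := abs_nbrSum_le G x v
  rw [hx, abs_mul] at h1
  have h2 := mul_le_mul_of_nonneg_left h1 (hf v).le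
  have h3 := mul_le_mul_of_nonneg_right (le_abs_self μ) (mul_nonneg (hf v).le (abs_nonneg (x v)))
  linarith

theorem eigenvalue_le_of_supersolution {μ c : ℝ} {x f : V → ℝ} (hf : ∀ v, 0 < f v)
    (hfc : ∀ v, nbrSum G f v ≤ c * f v) (hx0 : x ≠ 0) (hx : ∀ v, nbrSum G x v = μ * x v) :
    μ ≤ c := by
  obtain ⟨u, hu⟩ := Function.ne_iff.1 hx0
  have hpos : 0 < ∑ v, f v * |x v| :=
    Finset.sum_pos' (fun v _ => mul_nonneg (hf v).le (abs_nonneg _))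
      ⟨u, Finset.mem_univ _, mul_pos (hf u) (abs_pos.2 hu)⟩
  refine le_of_mul_le_mul_right
    ((sum_mul_abs_le_of_eigenvector G hf hx).trans ?_) hpos
  rw [Finset.mul_sum]
  refine Finset.sum_le_sum fun v _ => ?_
  nlinarith [mul_le_mul_of_nonneg_left (hfc v) (abs_nonneg (x v))]

theorem eigenvalue_lt_of_strict_supersolution {μ c : ℝ} {x f : V → ℝ} (hf : ∀ v, 0 < f v)
    (hfc : ∀ v, nbrSum G f v < c * f v) (hx0 : x ≠ 0) (hx : ∀ v, nbrSum G x v = μ * x v) :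
    μ < c := by
  obtain ⟨u, hu⟩ := Function.ne_iff.1 hx0
  have hpos : 0 < ∑ v, f v * |x v| :=
    Finset.sum_pos' (fun v _ => mul_nonneg (hf v).le (abs_nonneg _))
      ⟨u, Finset.mem_univ _, mul_pos (hf u) (abs_pos.2 hu)⟩
  refine lt_of_mul_lt_mul_right
    ((sum_mul_abs_le_of_eigenvector G hf hx).trans_lt ?_) hpos.le
  rw [Finset.mul_sum]
  refine Finset.sum_lt_sum (fun v _ => ?_) ⟨u, Finset.mem_univ _, ?_⟩
  · nlinarith [mul_le_mul_of_nonneg_left (hfc v).le (abs_nonneg (x v))]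
  · nlinarith [mul_lt_mul_of_pos_left (hfc u) (abs_pos.2 hu)]

theorem graphSpectralRadius_eq_of_pos_eigenvector [Nonempty V] [DecidableRel G.Adj] {μ : ℝ}
    {f : V → ℝ} (hf : ∀ v, 0 < f v) (h : ∀ v, nbrSum G f v = μ * f v) :
    graphSpectralRadius G = μ := by
  have hg := isGreatest_graphSpectralRadius G
  refine le_antisymm ?_ (hg.2 ?_)
  · obtain ⟨x, hx0, hx⟩ := (hasEigenvalue_iff_nbrSum G _).1 hg.1
    exact eigenvalue_le_of_supersolution G hf (fun v => (h v).le) hx0 hx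
  · refine (hasEigenvalue_iff_nbrSum G _).2 ⟨f, fun h0 => ?_, h⟩
    obtain ⟨v⟩ := ‹Nonempty V›
    exact (hf v).ne' (congrFun h0 v)

open Matrix in
-- The matrix `ρ - A` is positive semidefinite: an eigenvalue `e` of it makes `ρ - e` an eigenvalue
-- of `A`, hence at most `ρ`.
theorem sum_mul_nbrSum_le [Nonempty V] [DecidableRel G.Adj] (x : V → ℝ) :
    ∑ v, x v * nbrSum G x v ≤ graphSpectralRadius G * ∑ v, x v * x v := by
  classical
  have hA : (G.adjMatrix ℝ).IsHermitian := by
    rw [Matrix.IsHermitian, Matrix.conjTranspose_eq_transpose_of_trivial]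
    exact G.isSymm_adjMatrix
  set ρ := graphSpectralRadius G
  have hB : (ρ • (1 : Matrix V V ℝ) - G.adjMatrix ℝ).IsHermitian := by
    refine Matrix.IsHermitian.sub ?_ hA
    rw [Matrix.IsHermitian, Matrix.conjTranspose_eq_transpose_of_trivial]
    simp
  have hpsd : (ρ • (1 : Matrix V V ℝ) - G.adjMatrix ℝ).PosSemidef := by
    rw [hB.posSemidef_iff_eigenvalues_nonneg]
    intro i
    have hi := hB.mulVec_eigenvectorBasis i
    have hne : (hB.eigenvectorBasis i).ofLp ≠ 0 := by
      intro h0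
      apply hB.eigenvectorBasis.orthonormal.ne_zero i
      ext j
      exact congrFun h0 j
    have hle := (isGreatest_graphSpectralRadius G).2
      (show ρ - hB.eigenvalues i ∈ _ from (hasEigenvalue_iff_nbrSum G _).2
        ⟨_, hne, fun v => by
          have hv := congrFun hi v
          rw [Matrix.sub_mulVec, adjMatrix_mulVec_eq_nbrSum, Matrix.smul_mulVec] at hv
          simp only [one_mulVec, Pi.sub_apply, Pi.smul_apply, smul_eq_mul] at hv
          linarith⟩)
    simp only [Pi.zero_apply]
    linarith
  have h := hpsd.dotProduct_mulVec_nonneg x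
  rw [Matrix.sub_mulVec, adjMatrix_mulVec_eq_nbrSum, Matrix.smul_mulVec] at h
  simp only [star_trivial, one_mulVec, dotProduct_sub, dotProduct_smul, smul_eq_mul] at h
  simp only [dotProduct] at h
  linarith

end Spectral

/-! ### Necessity: bounds on the spectral radius by the maximum degree -/

section Bounds

variable {V : Type*} [Fintype V] (G : SimpleGraph V)

theorem nbrSum_eq_sum_neighborFinset [DecidableRel G.Adj] (x : V → ℝ) (v : V) :
    nbrSum G x v = ∑ w ∈ G.neighborFinset v, x w := by
  rw [← adjMatrix_mulVec_eq_nbrSum, SimpleGraph.adjMatrix_mulVec_apply]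

theorem sqrt_degree_le_graphSpectralRadius [DecidableRel G.Adj] (v : V) :
    √(G.degree v : ℝ) ≤ graphSpectralRadius G := by
  classical
  have : Nonempty V := ⟨v⟩
  set s := √(G.degree v : ℝ) with hs
  have hss : s * s = G.degree v := Real.mul_self_sqrt (Nat.cast_nonneg _)
  -- An isolated vertex is tested with its indicator, since the star vector below would vanish.
  rcases (Real.sqrt_nonneg (G.degree v : ℝ)).eq_or_lt with h0 | hpos
  · have h := sum_mul_nbrSum_le G (fun u => if u = v then 1 else 0)
    have h1 : nbrSum G (fun u => if u = v then 1 else 0) v = 0 := by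
      simp [nbrSum_eq_sum_neighborFinset]
    simp [h1] at h
    rw [hs, ← h0]
    exact h
  rw [← hs] at hpos
  -- The Perron vector of the star at `v`, extended by zero.
  let x : V → ℝ := fun u => (if u = v then s else 0) + if G.Adj v u then 1 else 0
  have hxv : x v = s := by simp [x]
  have hxw : ∀ w, G.Adj v w → x w = 1 := fun w hw => by simp [x, hw, hw.ne']
  have hx0 : ∀ w, 0 ≤ x w := fun w => by
    simp only [x]
    split_ifs <;> positivity
  have hcard : ∑ u, (if G.Adj v u then (1 : ℝ) else 0) = s * s := by
    rw [Finset.sum_boole, hss, ← SimpleGraph.card_neighborFinset_eq_degree,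
      SimpleGraph.neighborFinset_eq_filter]
  have hsq : ∑ u, x u * x u = s * s + s * s := by
    have : ∀ u, x u * x u = (if u = v then s * s else 0) + if G.Adj v u then 1 else 0 := by
      intro u
      by_cases huv : u = v
      · subst huv
        simp [x]
      · simp [x, huv]
    simp only [this, Finset.sum_add_distrib, hcard]
    simp
  have hlow : s * s * s + s * (s * s) ≤ ∑ u, x u * nbrSum G x u := by
    have : ∀ u, (if u = v then s * s * s else 0) + s * (if G.Adj v u then 1 else 0) ≤
        x u * nbrSum G x u := by
      intro u
      by_cases huv : u = v
      · subst huv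
        have : nbrSum G x u = s * s := by
          rw [nbrSum_eq_sum_neighborFinset, Finset.sum_congr rfl
            fun w hw => hxw w ((SimpleGraph.mem_neighborFinset _ _ _).1 hw)]
          simp [hss]
        rw [this, hxv]
        simp
        linarith
      · by_cases hadj : G.Adj v u
        · have : s ≤ nbrSum G x u := by
            rw [nbrSum_eq_sum_neighborFinset, ← hxv]
            exact Finset.single_le_sum (fun w _ => hx0 w)
              ((SimpleGraph.mem_neighborFinset _ _ _).2 hadj.symm)
          simpa [huv, hadj, hxw u hadj] using this
        · simp [huv, hadj, x]
    refine le_trans (le_of_eq ?_) (Finset.sum_le_sum fun u _ => this u)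
    rw [Finset.sum_add_distrib, ← Finset.mul_sum, hcard]
    simp
  have h := sum_mul_nbrSum_le G x
  rw [hsq] at h
  have h2 : s * (s * s + s * s) ≤ graphSpectralRadius G * (s * s + s * s) := by linarith
  exact le_of_mul_le_mul_right h2 (by positivity)

variable {G}

theorem SimpleGraph.IsTree.eq_of_adj_of_dist_lt {V : Type*} {G : SimpleGraph V} (hG : G.IsTree)
    {o v w₁ w₂ : V} (h₁ : G.Adj v w₁) (h₂ : G.Adj v w₂) (hd₁ : G.dist o w₁ < G.dist o v)
    (hd₂ : G.dist o w₂ < G.dist o v) : w₁ = w₂ := by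
  classical
  obtain ⟨p, hp, -⟩ := hG.connected.exists_path_of_dist o v
  have key : ∀ w, G.Adj v w → G.dist o w < G.dist o v → w = p.penultimate := by
    intro w hw hd
    obtain ⟨q, hq, hql⟩ := hG.connected.exists_path_of_dist o w
    refine hG.isAcyclic.eq_penultimate_of_adj_end hp hw
      (hG.isAcyclic.mem_support_of_ne_mem_support_of_adj_of_isPath hp hq hw fun hv => ?_)
    have := (SimpleGraph.dist_le (q.takeUntil v hv)).trans (q.length_takeUntil_le_length hv)
    omega
  rw [key w₁ h₁ hd₁, key w₂ h₂ hd₂]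

/-- The radial weight `s⁻¹ ^ d` alone gives equality at a non-root vertex of degree `r`. The
strictly concave factor `M - d ^ 2` makes the inequality strict. -/
theorem SimpleGraph.IsTree.exists_strict_supersolution (hG : G.IsTree) [DecidableRel G.Adj] {r : ℕ}
    (hr : 2 ≤ r) (hdeg : ∀ v, G.degree v ≤ r) :
    ∃ f : V → ℝ, (∀ v, 0 < f v) ∧ ∀ v, nbrSum G f v < 2 * √((r : ℝ) - 1) * f v := by
  classical
  obtain ⟨o⟩ := hG.connected.nonempty
  set s := √((r : ℝ) - 1) with hs
  have hr' : (2 : ℝ) ≤ r := by exact_mod_cast hr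
  have hss : s * s = r - 1 := Real.mul_self_sqrt (by linarith)
  have hs0 : 0 < s := Real.sqrt_pos.2 (by linarith)
  let d : V → ℝ := fun v => G.dist o v
  have hd0 : ∀ v, 0 ≤ d v := fun v => Nat.cast_nonneg _
  -- `M` exceeds `(d + 1) ^ 2`, so the weight stays positive one layer beyond the tree.
  let M : ℝ := 1 + ∑ v, (d v + 1) ^ 2
  have hM : ∀ v, (d v + 1) ^ 2 < M := fun v => by
    have := Finset.single_le_sum (f := fun v => (d v + 1) ^ 2) (fun w _ => by positivity)
      (Finset.mem_univ v)
    simp only [M]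
    linarith
  let f : V → ℝ := fun v => s⁻¹ ^ (G.dist o v) * (M - d v ^ 2)
  have hf : ∀ v, 0 < f v := fun v => by
    have h1 := hM v
    have h2 := hd0 v
    exact mul_pos (by positivity) (by nlinarith)
  refine ⟨f, hf, fun v => ?_⟩
  set F := s⁻¹ ^ (G.dist o v) with hF
  have hFpos : 0 < F := by positivity
  set b := F * s⁻¹ * (M - (d v + 1) ^ 2) with hb
  have hb0 : 0 ≤ b := mul_nonneg (by positivity) (by linarith [hM v])
  have hsb : s * s * b = s * F * (M - (d v + 1) ^ 2) := by
    rw [hb]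
    field_simp
  have hfar : ∀ w, G.Adj v w → ¬ G.dist o w < G.dist o v → f w = b := by
    intro w hw hlt
    have := (hG.dist_eq_dist_add_one_of_adj o hw).resolve_left (by omega)
    simp only [f, d, hb, hF, this, pow_succ]
    push_cast
    ring
  have hdegv : (G.degree v : ℝ) ≤ r := by exact_mod_cast hdeg v
  rw [nbrSum_eq_sum_neighborFinset]
  by_cases hex : ∃ p, G.Adj v p ∧ G.dist o p < G.dist o v
  · obtain ⟨p, hp, hpd⟩ := hex
    have hmem : p ∈ G.neighborFinset v := (SimpleGraph.mem_neighborFinset _ _ _).2 hp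
    have hfp : f p = F * s * (M - (d v - 1) ^ 2) := by
      have := (hG.dist_eq_dist_add_one_of_adj o hp).resolve_right (by omega)
      simp only [f, d, hF, this, pow_succ]
      push_cast
      field_simp
      ring
    rw [← Finset.add_sum_erase _ _ hmem, Finset.sum_congr rfl (g := fun _ => b)]
    · rw [Finset.sum_const, Finset.card_erase_of_mem hmem, SimpleGraph.card_neighborFinset_eq_degree,
        nsmul_eq_mul, hfp]
      have hpos : 1 ≤ G.degree v := Finset.card_pos.2 ⟨p, hmem⟩
      rw [Nat.cast_sub hpos]
      have h1 : ((G.degree v : ℝ) - (1 : ℕ)) * b ≤ s * s * b := by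
        refine mul_le_mul_of_nonneg_right ?_ hb0
        rw [hss]
        push_cast
        linarith
      have h2 : 0 < s * F := by positivity
      simp only [f]
      rw [← hF]
      nlinarith
    · intro w hw
      have hwadj := (SimpleGraph.mem_neighborFinset _ _ _).1 (Finset.mem_of_mem_erase hw)
      refine hfar w hwadj fun hlt => Finset.ne_of_mem_erase hw ?_
      exact hG.eq_of_adj_of_dist_lt hwadj hp hlt hpd
  -- With no neighbour nearer to `o`, up to `r` outward neighbours are absorbed by `r ≤ 2 * (r -
  -- 1)`.
  · push Not at hex
    rw [Finset.sum_congr rfl (g := fun _ => b) fun w hw => by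
      have hwadj := (SimpleGraph.mem_neighborFinset _ _ _).1 hw
      exact hfar w hwadj (not_lt.2 (hex w hwadj))]
    rw [Finset.sum_const, SimpleGraph.card_neighborFinset_eq_degree, nsmul_eq_mul]
    have h1 : (G.degree v : ℝ) * b ≤ 2 * (s * s) * b := by
      refine mul_le_mul_of_nonneg_right ?_ hb0
      rw [hss]
      linarith
    have h2 : 0 < s * F := by positivity
    have h3 : s * F * (M - (d v + 1) ^ 2) < s * F * (M - d v ^ 2) :=
      mul_lt_mul_of_pos_left (by nlinarith [hd0 v]) h2
    simp only [f]
    rw [← hF]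
    nlinarith

theorem SimpleGraph.IsTree.graphSpectralRadius_lt (hG : G.IsTree) [DecidableRel G.Adj] {r : ℕ}
    (hr : 2 ≤ r) (hdeg : ∀ v, G.degree v ≤ r) :
    graphSpectralRadius G < 2 * √((r : ℝ) - 1) := by
  have := hG.connected.nonempty
  obtain ⟨f, hf, hfs⟩ := hG.exists_strict_supersolution hr hdeg
  obtain ⟨x, hx0, hx⟩ := (hasEigenvalue_iff_nbrSum G _).1 (isGreatest_graphSpectralRadius G).1
  exact eigenvalue_lt_of_strict_supersolution G hf hfs hx0 hx

theorem SimpleGraph.IsTree.bounds_of_graphSpectralRadius_eq_sqrt (hG : G.IsTree)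
    [DecidableRel G.Adj] {k : ℕ} (hr : 2 ≤ G.maxDegree) (h : graphSpectralRadius G = √(k : ℝ)) :
    (k : ℝ) / 4 + 1 < (G.maxDegree : ℝ) ∧ (G.maxDegree : ℝ) ≤ (k : ℝ) := by
  have := hG.connected.nonempty
  have hr' : (2 : ℝ) ≤ G.maxDegree := by exact_mod_cast hr
  constructor
  · have h1 := hG.graphSpectralRadius_lt hr G.degree_le_maxDegree
    have h2 : (2 : ℝ) * √((G.maxDegree : ℝ) - 1) = √(4 * ((G.maxDegree : ℝ) - 1)) := by
      rw [Real.sqrt_mul (by norm_num), show (4 : ℝ) = 2 ^ 2 by norm_num,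
        Real.sqrt_sq (by norm_num)]
    rw [h, h2] at h1
    have := lt_of_not_ge fun hle => h1.not_ge (Real.sqrt_le_sqrt hle)
    linarith
  · obtain ⟨v, hv⟩ := G.exists_maximal_degree_vertex
    have h1 := sqrt_degree_le_graphSpectralRadius G v
    rw [h, ← hv] at h1
    exact (Real.sqrt_le_sqrt_iff (Nat.cast_nonneg _)).1 h1

end Bounds

/-! ### Joining two trees by an edge -/

theorem SimpleGraph.IsTree.sum_sup_edge {V W : Type*} [Finite V] [Finite W] {G : SimpleGraph V}
    {H : SimpleGraph W} (hG : G.IsTree) (hH : H.IsTree) (v : V) (w : W) :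
    ((G ⊕g H) ⊔ SimpleGraph.edge (Sum.inl v) (Sum.inr w)).IsTree := by
  classical
  have hconn := hG.connected.sum_sup_edge (v := v) (w := w) hH.connected
  rw [SimpleGraph.isTree_iff_connected_and_card] at hG hH ⊢
  refine ⟨hconn, ?_⟩
  have he : ((G ⊕g H) ⊔ SimpleGraph.edge (Sum.inl v) (Sum.inr w)).edgeSet =
      insert s(Sum.inl v, Sum.inr w) (G ⊕g H).edgeSet := by
    have hne : (Sum.inl v : V ⊕ W) ≠ Sum.inr w := Sum.inl_ne_inr
    rw [SimpleGraph.edgeSet_sup, SimpleGraph.edgeSet_edge_of_ne hne, Set.insert_eq, Set.union_comm]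
  have hs : Nat.card (G ⊕g H).edgeSet = Nat.card G.edgeSet + Nat.card H.edgeSet := by
    rw [Nat.card_congr SimpleGraph.edgeSetSumEquiv, Nat.card_sum]
  rw [he, Nat.card_coe_set_eq, Set.ncard_insert_of_notMem (by simp), ← Nat.card_coe_set_eq, hs,
    Nat.card_sum]
  omega

section Gluing

variable {V W : Type*} [Fintype V] [Fintype W] (G : SimpleGraph V) (H : SimpleGraph W)

theorem nbrSum_sum_sup_edge_inl (x : V ⊕ W → ℝ) (o u : V) (p : W) :
    nbrSum ((G ⊕g H) ⊔ SimpleGraph.edge (Sum.inl o) (Sum.inr p)) x (Sum.inl u) =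
      nbrSum G (fun v => x (Sum.inl v)) u +
        open Classical in if u = o then x (Sum.inr p) else 0 := by
  classical
  unfold nbrSum
  rw [Fintype.sum_sum_type]
  congr 1
  · refine Finset.sum_congr rfl fun v _ => ?_
    simp [SimpleGraph.edge_adj]
  · by_cases huo : u = o <;> simp [SimpleGraph.edge_adj, huo]

theorem nbrSum_sum_sup_edge_inr (x : V ⊕ W → ℝ) (o : V) (p w : W) :
    nbrSum ((G ⊕g H) ⊔ SimpleGraph.edge (Sum.inl o) (Sum.inr p)) x (Sum.inr w) =
      nbrSum H (fun v => x (Sum.inr v)) w +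
        open Classical in if w = p then x (Sum.inl o) else 0 := by
  classical
  unfold nbrSum
  rw [Fintype.sum_sum_type, add_comm]
  congr 1
  · refine Finset.sum_congr rfl fun v _ => ?_
    simp [SimpleGraph.edge_adj]
  · by_cases hwp : w = p <;> simp [SimpleGraph.edge_adj, hwp]

theorem nbrSum_const_mul (x : V → ℝ) (c : ℝ) (v : V) :
    nbrSum G (fun w => c * x w) v = c * nbrSum G x v := by
  classical
  simp only [nbrSum, Finset.mul_sum]
  exact Finset.sum_congr rfl fun w _ => by split_ifs <;> simp

end Gluing

/-! ### Rooted trees with an eigenvector defect at the root -/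

/-- There are a finite tree with root `o` and a positive vector `x` on it which satisfies the
eigenvalue equation for `√k` off the root, and at the root with `k` replaced by `k - D`; the root
has degree `n`, the other degrees are at most `r`, and if `f` holds, one of them is `r`. -/
def RootedTreeExists (k r : ℕ) (D : ℝ) (n : ℕ) (f : Prop) : Prop :=
  ∃ (V : Type) (_ : Fintype V) (G : SimpleGraph V) (o : V) (x : V → ℝ),
    G.IsTree ∧ (∀ v, 0 < x v) ∧ (∀ v, v ≠ o → nbrSum G x v = √k * x v) ∧
      √k * nbrSum G x o = (k - D) * x o ∧ (∀ v, v ≠ o → nbrSum G 1 v ≤ r) ∧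
        nbrSum G 1 o = n ∧ (f → ∃ v, v ≠ o ∧ nbrSum G 1 v = r)

namespace RootedTreeExists

variable {k r : ℕ}

theorem mono {D : ℝ} {n : ℕ} {f f' : Prop} (h : RootedTreeExists k r D n f) (hf : f' → f) :
    RootedTreeExists k r D n f' := by
  obtain ⟨V, hV, G, o, x, h1, h2, h3, h4, h5, h6, h7⟩ := h
  exact ⟨V, hV, G, o, x, h1, h2, h3, h4, h5, h6, h7 ∘ hf⟩

theorem singleton : RootedTreeExists k r k 0 False := by
  refine ⟨Unit, inferInstance, ⊥, (), fun _ => 1, SimpleGraph.IsTree.of_subsingleton,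
    fun _ => one_pos, fun v hv => absurd rfl hv, ?_, fun v hv => absurd rfl hv, ?_, False.elim⟩ <;>
  simp [nbrSum]

theorem attach (hk : 0 < k) {D₁ D₂ : ℝ} {n₁ n₂ : ℕ} {f₁ f₂ : Prop}
    (h₁ : RootedTreeExists k r D₁ n₁ f₁) (h₂ : RootedTreeExists k r D₂ n₂ f₂) (hD : 0 < D₂)
    (hn : n₂ + 1 ≤ r) :
    RootedTreeExists k r (D₁ - k / D₂) (n₁ + 1) (f₁ ∨ f₂ ∨ n₂ + 1 = r) := by
  classical
  obtain ⟨V, hV, G, o, x, hG, hx, hxo, hxr, hd, hdo, hf₁⟩ := h₁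
  obtain ⟨W, hW, H, p, y, hH, hy, hyo, hyr, he, hep, hf₂⟩ := h₂
  have hk' : (0 : ℝ) < k := by exact_mod_cast hk
  have hsk : 0 < √(k : ℝ) := Real.sqrt_pos.2 hk'
  have hss : √(k : ℝ) * √(k : ℝ) = k := Real.mul_self_sqrt hk'.le
  have hop := hx o
  have hpp := hy p
  -- The scaling of `y` that makes the eigenvalue equation hold at `p` once `o` is its neighbour.
  set c := √(k : ℝ) * x o / (D₂ * y p) with hc
  have hc0 : 0 < c := by positivity
  have hcD : c * (D₂ * y p) = √(k : ℝ) * x o := div_mul_cancel₀ _ (by positivity)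
  refine ⟨V ⊕ W, inferInstance, (G ⊕g H) ⊔ SimpleGraph.edge (Sum.inl o) (Sum.inr p), Sum.inl o,
    Sum.elim x fun w => c * y w, hG.sum_sup_edge hH o p, ?_, ?_, ?_, ?_, ?_, ?_⟩
  · rintro (v | w)
    · exact hx v
    · exact mul_pos hc0 (hy w)
  · rintro (v | w) hv
    · have hvo : v ≠ o := fun h => hv (by rw [h])
      simp only [nbrSum_sum_sup_edge_inl, Sum.elim_inl, if_neg hvo, add_zero]
      exact hxo v hvo
    · simp only [nbrSum_sum_sup_edge_inr, Sum.elim_inr, Sum.elim_inl, nbrSum_const_mul]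
      by_cases hw : w = p
      · subst hw
        rw [if_pos rfl]
        refine mul_left_cancel₀ hsk.ne' ?_
        linear_combination c * hyr + hcD.symm - c * y w * hss
      · rw [if_neg hw, hyo w hw]
        ring
  · simp only [nbrSum_sum_sup_edge_inl, Sum.elim_inl, Sum.elim_inr, if_true]
    rw [mul_add, hxr, hc]
    field_simp
    linear_combination hss
  · rintro (v | w) hv
    · have hvo : v ≠ o := fun h => hv (by rw [h])
      rw [nbrSum_sum_sup_edge_inl, if_neg hvo, add_zero]
      exact hd v hvo
    · rw [nbrSum_sum_sup_edge_inr]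
      by_cases hw : w = p
      · subst hw
        rw [if_pos rfl]
        have : ((n₂ + 1 : ℕ) : ℝ) ≤ r := by exact_mod_cast hn
        push_cast at this
        exact (add_le_add_left hep.le _).trans this
      · rw [if_neg hw, add_zero]
        exact he w hw
  · rw [nbrSum_sum_sup_edge_inl, if_pos rfl]
    push_cast
    exact congrArg (· + 1) hdo
  · rintro (h | h | h)
    · obtain ⟨v, hvo, hv⟩ := hf₁ h
      refine ⟨Sum.inl v, fun h => hvo (Sum.inl_injective h), ?_⟩
      rw [nbrSum_sum_sup_edge_inl, if_neg hvo, add_zero]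
      exact hv
    · obtain ⟨w, hwp, hw⟩ := hf₂ h
      refine ⟨Sum.inr w, Sum.inr_ne_inl, ?_⟩
      rw [nbrSum_sum_sup_edge_inr, if_neg hwp, add_zero]
      exact hw
    · refine ⟨Sum.inr p, Sum.inr_ne_inl, ?_⟩
      rw [nbrSum_sum_sup_edge_inr, if_pos rfl, ← h]
      push_cast
      exact congrArg (· + 1) hep

theorem attach_many (hk : 0 < k) {D₁ D₂ : ℝ} {n₁ n₂ : ℕ} {f₁ f₂ : Prop}
    (h₁ : RootedTreeExists k r D₁ n₁ f₁) (h₂ : RootedTreeExists k r D₂ n₂ f₂) (hD : 0 < D₂)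
    (hn : n₂ + 1 ≤ r) (m : ℕ) :
    RootedTreeExists k r (D₁ - m * (k / D₂)) (n₁ + m) (f₁ ∨ 0 < m ∧ (f₂ ∨ n₂ + 1 = r)) := by
  induction m with
  | zero => simpa using h₁.mono (f' := f₁) id
  | succ m ih =>
    have h := ih.attach hk h₂ hD hn
    rw [show D₁ - m * (k / D₂) - k / D₂ = D₁ - (m + 1 : ℕ) * (k / D₂) by push_cast; ring] at h
    exact h.mono (by tauto)

theorem exists_tree {n : ℕ} {f : Prop} (hk : 0 < k) (h : RootedTreeExists k r 0 n f) (hn : n ≤ r)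
    (hf : f ∨ n = r) :
    ∃ (V : Type) (_ : Fintype V) (T : SimpleGraph V) (_ : DecidableRel T.Adj),
      T.IsTree ∧ graphSpectralRadius T = √(k : ℝ) ∧ T.maxDegree = r := by
  classical
  obtain ⟨V, hV, G, o, x, hG, hx, hxo, hxr, hd, hdo, hfv⟩ := h
  have hsk : 0 < √(k : ℝ) := Real.sqrt_pos.2 (by exact_mod_cast hk)
  have hss : √(k : ℝ) * √(k : ℝ) = k := Real.mul_self_sqrt (Nat.cast_nonneg _)
  have : Nonempty V := ⟨o⟩
  refine ⟨V, hV, G, Classical.decRel _, hG,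
    graphSpectralRadius_eq_of_pos_eigenvector G hx fun v => ?_, le_antisymm ?_ ?_⟩
  · by_cases hv : v = o
    · subst hv
      refine mul_left_cancel₀ hsk.ne' ?_
      linear_combination hxr - x v * hss
    · exact hxo v hv
  · refine G.maxDegree_le_of_forall_degree_le r fun v => ?_
    by_cases hv : v = o
    · subst hv
      rw [nbrSum_one] at hdo
      exact (Nat.cast_injective hdo).trans_le hn
    · have := hd v hv
      rw [nbrSum_one] at this
      exact_mod_cast this
  · obtain ⟨v, hv⟩ : ∃ v, nbrSum G 1 v = r := by
      rcases hf with hf | rfl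
      · obtain ⟨v, -, hv⟩ := hfv hf
        exact ⟨v, hv⟩
      · exact ⟨o, hdo⟩
    rw [nbrSum_one] at hv
    rw [← Nat.cast_injective hv]
    exact G.degree_le_maxDegree v

end RootedTreeExists

/-! ### Branches and the level coordinate -/

/-- Rooted trees as in `RootedTreeExists` whose root may be joined to a further vertex; if `f`
holds, then some vertex has degree `r` afterwards. -/
def BranchExists (k r : ℕ) (D : ℝ) (f : Prop) : Prop :=
  ∃ (n : ℕ) (f' : Prop), n + 1 ≤ r ∧ RootedTreeExists k r D n f' ∧ (f → f' ∨ n + 1 = r)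

/-- A branch `k * X / (2 * (X - 1))`, so that the ratio of the scaled entry at the root to the entry
at the vertex it is attached to is `2 - 2 / X`; the degree `r` is attained off the root if `f`. -/
def LevelExists (k r : ℕ) (X : ℝ) (f : Prop) : Prop :=
  ∃ n : ℕ, n + 1 ≤ r ∧ RootedTreeExists k r (k * X / (2 * (X - 1))) n f

section Levels

variable {k r : ℕ}

theorem RootedTreeExists.branch {D : ℝ} {n : ℕ} {f : Prop} (h : RootedTreeExists k r D n f)
    (hn : n + 1 ≤ r) : BranchExists k r D (f ∨ n + 1 = r) :=
  ⟨n, f, hn, h, id⟩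

theorem BranchExists.mono {D : ℝ} {f f' : Prop} (h : BranchExists k r D f) (hf : f' → f) :
    BranchExists k r D f' := by
  obtain ⟨n, g, hn, h, hg⟩ := h
  exact ⟨n, g, hn, h, hg ∘ hf⟩

theorem branchExists_leaf (hr : 1 ≤ r) : BranchExists k r k False :=
  (RootedTreeExists.singleton.branch (by omega)).mono False.elim

theorem BranchExists.node (hk : 0 < k) {D₁ D₂ : ℝ} {f₁ f₂ : Prop} (h₁ : BranchExists k r D₁ f₁)
    (h₂ : BranchExists k r D₂ f₂) (hD₁ : 0 < D₁) (hD₂ : 0 < D₂) (m l : ℕ) :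
    RootedTreeExists k r (k - m * (k / D₁) - l * (k / D₂)) (m + l)
      (0 < m ∧ f₁ ∨ 0 < l ∧ f₂) := by
  obtain ⟨n₁, g₁, hn₁, h₁, hg₁⟩ := h₁
  obtain ⟨n₂, g₂, hn₂, h₂, hg₂⟩ := h₂
  have h := (RootedTreeExists.singleton.attach_many hk h₁ hD₁ hn₁ m).attach_many hk h₂ hD₂ hn₂ l
  rw [zero_add] at h
  exact h.mono (by tauto)

theorem levelExists_two (hr : 1 ≤ r) : LevelExists k r 2 False := by
  refine ⟨0, by omega, ?_⟩
  rw [show (k : ℝ) * 2 / (2 * (2 - 1)) = k by ring]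
  exact RootedTreeExists.singleton

theorem LevelExists.exists_tree (hk : 0 < k) (h : LevelExists k r 0 True) :
    ∃ (V : Type) (_ : Fintype V) (T : SimpleGraph V) (_ : DecidableRel T.Adj),
      T.IsTree ∧ graphSpectralRadius T = √(k : ℝ) ∧ T.maxDegree = r := by
  obtain ⟨n, hn, h⟩ := h
  rw [mul_zero, zero_div] at h
  exact h.exists_tree hk (by omega) (Or.inl trivial)

theorem level_pos (hk : 0 < k) {X : ℝ} (hX : X < 0 ∨ 1 < X) : 0 < k * X / (2 * (X - 1)) := by
  have hk' : (0 : ℝ) < k := by exact_mod_cast hk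
  rcases hX with hX | hX
  · exact div_pos_of_neg_of_neg (mul_neg_of_pos_of_neg hk' hX) (by linarith)
  · exact div_pos (mul_pos hk' (by linarith)) (by linarith)

theorem div_level (hk : 0 < k) {X : ℝ} (hX : X < 0 ∨ 1 < X) :
    (k : ℝ) / (k * X / (2 * (X - 1))) = 2 * (X - 1) / X := by
  have hk' : (k : ℝ) ≠ 0 := by exact_mod_cast hk.ne'
  have h0 : X ≠ 0 := by rcases hX with h | h <;> intro h0 <;> linarith
  have h1 : X - 1 ≠ 0 := by rcases hX with h | h <;> intro h0 <;> linarith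
  field_simp

theorem LevelExists.branch {X : ℝ} {f : Prop} (h : LevelExists k r X f) :
    BranchExists k r (k * X / (2 * (X - 1))) f := by
  obtain ⟨n, hn, h⟩ := h
  exact (h.branch hn).mono Or.inl

/-- A root with `m` children of level `X` and `l` children that are leaves. -/
theorem LevelExists.node {X : ℝ} {f : Prop} (h : LevelExists k r X f) (hk : 0 < k)
    (hX : X < 0 ∨ 1 < X) {m l : ℕ} (hml : m + l + 1 ≤ r) {D : ℝ}
    (hD : D = k - m * (2 * (X - 1) / X) - l) :
    BranchExists k r D (0 < m ∧ f ∨ m + l + 1 = r) := by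
  have hk' : (0 : ℝ) < k := by exact_mod_cast hk
  have h2 := (h.branch.node hk (branchExists_leaf (by omega)) (level_pos hk hX) hk' m l).branch hml
  rw [div_level hk hX, div_self hk'.ne', mul_one, ← hD] at h2
  exact h2.mono (by tauto)

/-- Here `hX` is `k - n * (k / D) = k * X / (2 * (X - 1))` cleared of denominators. -/
theorem BranchExists.level {D X : ℝ} {f : Prop} (h : BranchExists k r D f) (hk : 0 < k)
    (hD : 0 < D) {n : ℕ} (hn0 : 0 < n) (hn : n + 1 ≤ r) (hX1 : X ≠ 1)
    (hX : 2 * (X - 1) * (D - n) = D * X) : LevelExists k r X f := by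
  have h2 := h.node hk (branchExists_leaf (k := k) (by omega)) hD (by exact_mod_cast hk) n 0
  refine ⟨n, hn, ?_⟩
  have h1 : X - 1 ≠ 0 := sub_ne_zero.2 hX1
  rw [show (k : ℝ) * X / (2 * (X - 1)) = k - n * (k / D) - (0 : ℕ) * (k / k) by
    push_cast
    field_simp
    linear_combination -(k : ℝ) * hX]
  exact h2.mono (by tauto)

theorem LevelExists.step {X X' : ℝ} {f : Prop} (h : LevelExists k r X f) (hk : 0 < k)
    (hX : X < 0 ∨ 1 < X) {m l n : ℕ} (hm : 0 < m) (hml : m + l + 1 ≤ r) (hn0 : 0 < n)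
    (hn : n + 1 ≤ r) {D : ℝ} (hD : D = k - m * (2 * (X - 1) / X) - l) (hD0 : 0 < D) (hX1 : X' ≠ 1)
    (hX' : 2 * (X' - 1) * (D - n) = D * X') : LevelExists k r X' (f ∨ m + l + 1 = r) :=
  ((h.node hk hX hml hD).mono (by tauto)).level hk hD0 hn0 hn hX1 hX'

theorem LevelExists.mono {X : ℝ} {f f' : Prop} (h : LevelExists k r X f) (hf : f' → f) :
    LevelExists k r X f' := by
  obtain ⟨n, hn, h⟩ := h
  exact ⟨n, hn, h.mono hf⟩

theorem LevelExists.add_mul {c : ℝ} {f : Prop} {X : ℝ} (h : LevelExists k r X f)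
    (hstep : ∀ Y, X ≤ Y → LevelExists k r Y f → LevelExists k r (Y + c) f) (hc : 0 ≤ c) (j : ℕ) :
    LevelExists k r (X + j * c) f := by
  induction j with
  | zero => simpa using h
  | succ j ih =>
    have h := hstep _ (le_add_of_nonneg_right (by positivity)) ih
    rwa [show X + j * c + c = X + (j + 1 : ℕ) * c by push_cast; ring] at h

/-- Restricting the step to `Y ≤ -c` keeps its result at most `0`, short of the levels in `(0, 1)`
where `D` is negative. -/
theorem LevelExists.zero_of_neg_mul {c : ℝ} {f : Prop} (hc : 0 ≤ c)
    (hstep : ∀ Y, Y ≤ -c → LevelExists k r Y f → LevelExists k r (Y + c) f) (j : ℕ)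
    (h : LevelExists k r (-(j * c)) f) : LevelExists k r 0 f := by
  induction j with
  | zero => simpa using h
  | succ j ih =>
    have h := hstep _ (by push_cast; nlinarith [mul_nonneg (Nat.cast_nonneg (α := ℝ) j) hc]) h
    rw [show -((j + 1 : ℕ) * c) + c = -(j * c) by push_cast; ring] at h
    exact ih h

/-! ### Translation by 2: equal branching `g` in both generations -/

section Uniform

variable {g l : ℕ}

theorem LevelExists.add_two {X : ℝ} {f : Prop} (h : LevelExists k r X f) (hg : 1 ≤ g)
    (hk : k = 4 * g + l) (hr : g + l + 1 ≤ r) (hX : X ≤ -2 ∨ 2 ≤ X) :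
    LevelExists k r (X + 2) f := by
  have hkr : (k : ℝ) = 4 * g + l := by exact_mod_cast hk
  have hg' : (1 : ℝ) ≤ g := by exact_mod_cast hg
  have hX0 : X ≠ 0 := by rintro rfl; norm_num at hX
  have hD : 0 < 2 * g * (X + 1) / X := by
    rcases hX with hX | hX
    · exact div_pos_of_neg_of_neg (by nlinarith) (by linarith)
    · exact div_pos (by nlinarith) (by linarith)
  refine (h.step (by omega) (m := g) (l := l) (n := g) (D := 2 * g * (X + 1) / X) ?_ (by omega) hr
    (by omega) (by omega) ?_ hD ?_ ?_).mono Or.inl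
  · rcases hX with hX | hX
    · left; linarith
    · right; linarith
  · rw [hkr]
    field_simp
    ring
  · intro h1
    rcases hX with hX | hX <;> linarith
  · field_simp
    ring

theorem levelExists_even (hg : 1 ≤ g) (hk : k = 4 * g + l) (hr : g + l + 1 ≤ r) (j : ℕ) :
    LevelExists k r (2 + j * 2) False :=
  (levelExists_two (by omega)).add_mul (fun _ hY h => h.add_two hg hk hr (Or.inr hY))
    (by norm_num) j

/-- A branch with root degree `r` after attaching, for which `D` is an odd number. -/
theorem exists_odd_full_branch (hg : 1 ≤ g) (hk : k = 4 * g + l) (hr : g + l + 1 ≤ r)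
    (hr' : g + 2 ≤ r) (hrk : r ≤ k) : ∃ j : ℕ, BranchExists k r (2 * j + 1) True := by
  have hk0 : 0 < k := by omega
  -- Leaves alone give `D = k - r + 1`. For the other parity, two children of level `4` cost `3 / 2`
  -- each, so replacing two leaves by them lowers `D` by one.
  rcases Nat.even_or_odd' (k - r) with ⟨j, hj | hj⟩
  · refine ⟨j, ((levelExists_two (k := k) (r := r) (by omega)).node hk0 (by norm_num) (m := 0)
      (l := r - 1) (by omega) ?_).mono (by intro _; right; omega)⟩
    rw [show k = 2 * j + r by omega, Nat.cast_sub (by omega)]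
    push_cast
    ring
  · refine ⟨j, ((levelExists_even hg hk hr 1).node hk0 (by norm_num) (m := 2)
      (l := r - 3) (by omega) ?_).mono (by intro _; right; omega)⟩
    rw [show k = 2 * j + 1 + r by omega, Nat.cast_sub (by omega)]
    push_cast
    ring

theorem exists_tree_uniform (hg : 1 ≤ g) (hk : k = 4 * g + l) (hr : g + l + 1 ≤ r)
    (hr' : g + 2 ≤ r) (hrk : r ≤ k) :
    ∃ (V : Type) (_ : Fintype V) (T : SimpleGraph V) (_ : DecidableRel T.Adj),
      T.IsTree ∧ graphSpectralRadius T = √(k : ℝ) ∧ T.maxDegree = r := by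
  have hk0 : 0 < k := by omega
  have hk0' : (0 : ℝ) < k := by exact_mod_cast hk0
  have hkr : (k : ℝ) = 4 * g + l := by exact_mod_cast hk
  have hg' : (1 : ℝ) ≤ g := by exact_mod_cast hg
  obtain ⟨j, hB⟩ := exists_odd_full_branch hg hk hr hr' hrk
  have hM : (0 : ℝ) < 2 * j + 1 := by positivity
  suffices h : LevelExists k r (-(j * 2)) True from
    LevelExists.exists_tree hk0 (LevelExists.zero_of_neg_mul (by norm_num)
      (fun _ hY h => h.add_two hg hk hr (Or.inl hY)) j h)
  rcases j with _ | j
  · have h := (branchExists_leaf (by omega)).node hk0 hB hk0' hM 0 1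
    refine ⟨0 + 1, by omega, ?_⟩
    rw [show (k : ℝ) * -((0 : ℕ) * 2) / (2 * (-((0 : ℕ) * 2) - 1)) =
        k - (0 : ℕ) * (k / k) - (1 : ℕ) * (k / (2 * (0 : ℕ) + 1)) by push_cast; ring]
    exact h.mono (by tauto)
  -- The odd branch has `D = X + 1`; next to `g` branches with `D = 2 * g * (X + 1) / X` it turns
  -- level `X` into `-X`.
  · set X : ℝ := 2 + j * 2 with hX
    have hX2 : 2 ≤ X := by simp [hX]
    have hD : 0 < 2 * g * (X + 1) / X := by positivity
    have hZ := (levelExists_even hg hk hr j).node hk0 (by right; linarith) (m := g) (l := l) hr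
      (D := 2 * g * (X + 1) / X) (by rw [hkr, ← hX]; field_simp; ring)
    have h := hZ.node hk0 hB hD hM g 1
    refine ⟨g + 1, by omega, ?_⟩
    have h1 : (2 : ℝ) * ((j + 1 : ℕ) : ℝ) + 1 = X + 1 := by rw [hX]; push_cast; ring
    have h2 : -(((j + 1 : ℕ) : ℝ) * 2) = -X := by rw [hX]; push_cast; ring
    rw [show (k : ℝ) * -((j + 1 : ℕ) * 2) / (2 * (-((j + 1 : ℕ) * 2) - 1)) =
        k - g * (k / (2 * g * (X + 1) / X)) - (1 : ℕ) * (k / (2 * (j + 1 : ℕ) + 1)) by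
        rw [h1, h2]
        have : -X - 1 ≠ 0 := by linarith
        push_cast
        field_simp
        ring]
    exact h.mono (by tauto)

end Uniform

end Levels

/-! ### Alternating the slopes `g / (g + 1)` and `(g + 1) / g` -/

section Alternating

variable {k r g l : ℕ}

theorem LevelExists.step_expand {X : ℝ} {f : Prop} (h : LevelExists k r X f) (hg : 1 ≤ g)
    (hk : k = 4 * g + 2 + l) (hr : g + l + 1 ≤ r) (hr' : g + 2 ≤ r)
    (hX : (g + 1) * X + 2 * g ≤ 0 ∨ 2 ≤ X) : LevelExists k r ((g + 1) * X / g + 2) f := by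
  have hkr : (k : ℝ) = 4 * g + 2 + l := by exact_mod_cast hk
  have hg' : (1 : ℝ) ≤ g := by exact_mod_cast hg
  have hXs : X < 0 ∨ 1 < X := by
    rcases hX with hX | hX
    · left; by_contra h0; nlinarith
    · right; linarith
  have hX0 : X ≠ 0 := by rintro rfl; norm_num at hXs
  have hg0 : (g : ℝ) ≠ 0 := by positivity
  have hD : 0 < 2 * ((g + 1) * X + g) / X := by
    rcases hX with hX | hX
    · exact div_pos_of_neg_of_neg (by linarith) (by rcases hXs with h | h <;> nlinarith)
    · exact div_pos (by nlinarith) (by linarith)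
  refine (h.step (by omega) hXs (m := g) (l := l) (n := g + 1)
    (D := 2 * ((g + 1) * X + g) / X) (by omega) hr (by omega) (by omega) ?_ hD ?_ ?_).mono Or.inl
  · rw [hkr]
    field_simp
    ring
  · intro h1
    have h2 : (g + 1) * X + g = 0 := by
      field_simp at h1
      linarith
    rw [h2] at hD
    simp at hD
  · push_cast
    field_simp
    ring

theorem LevelExists.node_contract {X : ℝ} {f : Prop} (h : LevelExists k r X f) (hg : 1 ≤ g)
    (hk : k = 4 * g + 2 + l) (hr : r = g + 2 + l) (hX : g * X + 2 * (g + 1) ≤ 0 ∨ 2 ≤ X) :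
    BranchExists k r (2 * (g * X + g + 1) / X) True ∧ 0 < 2 * (g * X + g + 1) / X := by
  have hkr : (k : ℝ) = 4 * g + 2 + l := by exact_mod_cast hk
  have hg' : (1 : ℝ) ≤ g := by exact_mod_cast hg
  have hXs : X < 0 ∨ 1 < X := by
    rcases hX with hX | hX
    · left; by_contra h0; nlinarith
    · right; linarith
  have hX0 : X ≠ 0 := by rintro rfl; norm_num at hXs
  refine ⟨(h.node (by omega) hXs (m := g + 1) (l := l) (by omega) ?_).mono
    (by intro _; right; omega), ?_⟩
  · rw [hkr]
    push_cast
    field_simp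
    ring
  · rcases hX with hX | hX
    · exact div_pos_of_neg_of_neg (by linarith) (by rcases hXs with h | h <;> nlinarith)
    · exact div_pos (by nlinarith) (by linarith)

theorem LevelExists.step_contract {X : ℝ} {f : Prop} (h : LevelExists k r X f) (hg : 1 ≤ g)
    (hk : k = 4 * g + 2 + l) (hr : r = g + 2 + l) (hX : g * X + 2 * (g + 1) ≤ 0 ∨ 2 ≤ X) :
    LevelExists k r (g * X / (g + 1) + 2) True := by
  have hg' : (1 : ℝ) ≤ g := by exact_mod_cast hg
  obtain ⟨hB, hD⟩ := h.node_contract hg hk hr hX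
  have hX0 : X ≠ 0 := by rintro rfl; norm_num at hD
  refine hB.level (by omega) hD (n := g) (by omega) (by omega) ?_ ?_
  · intro h1
    have h2 : g * X + g + 1 = 0 := by
      field_simp at h1
      linarith
    rw [h2] at hD
    simp at hD
  · field_simp
    ring

/-- The two slopes are reciprocal, so the composite is a translation. -/
theorem LevelExists.step_contract_expand {X : ℝ} {f : Prop} (h : LevelExists k r X f)
    (hg : 1 ≤ g) (hk : k = 4 * g + 2 + l) (hr : r = g + 2 + l)
    (hX : X ≤ -((4 * g + 2) / g) ∨ 2 ≤ X) : LevelExists k r (X + (4 * g + 2) / g) True := by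
  have hg' : (1 : ℝ) ≤ g := by exact_mod_cast hg
  have hX' : g * X + (4 * g + 2) ≤ 0 ∨ 2 ≤ X := by
    refine hX.imp_left fun hX => ?_
    rw [le_neg, div_le_iff₀ (by linarith)] at hX
    linarith
  have h1 := h.step_contract hg hk hr (hX'.imp_left fun _ => by linarith)
  have h2 := h1.step_expand hg hk (by omega) (by omega) <| hX'.imp
    (fun hX => by
      rw [mul_add, mul_div_cancel₀ _ (by positivity)]
      linarith)
    (fun hX => by
      have : 0 ≤ g * X / (g + 1 : ℝ) := by positivity
      linarith)
  rwa [show (g + 1) * (g * X / (g + 1) + 2) / g + 2 = X + (4 * g + 2) / (g : ℝ) by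
    field_simp; ring] at h2

theorem exists_tree_alternating (hg : 1 ≤ g) (hk : k = 4 * g + 2 + l) (hr : r = g + 2 + l)
    (hl : l ≤ 1) :
    ∃ (V : Type) (_ : Fintype V) (T : SimpleGraph V) (_ : DecidableRel T.Adj),
      T.IsTree ∧ graphSpectralRadius T = √(k : ℝ) ∧ T.maxDegree = r := by
  have hk0 : 0 < k := by omega
  have hkr : (k : ℝ) = 4 * g + 2 + l := by exact_mod_cast hk
  have hg' : (1 : ℝ) ≤ g := by exact_mod_cast hg
  have hX : LevelExists k r (4 * g + 4) False := by
    have := (levelExists_two (k := k) (r := r) (by omega)).add_mul (c := (4 * g + 2) / g)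
      (fun _ hY h => (h.step_contract_expand hg hk hr (Or.inr hY)).mono fun _ => trivial)
      (by positivity) g
    rwa [show (2 : ℝ) + g * ((4 * g + 2) / g) = 4 * g + 4 by field_simp; ring] at this
  obtain ⟨hB, hD⟩ := hX.node_contract hg hk hr (Or.inr (by linarith))
  -- `hB` has value `(4 * g + 1) / 2`, so `g` copies of it and one branch of value `4 * g + 1` leave
  -- `2 * g * k / (4 * g + 1)`, which is level `-4 * g`.
  have hB' : BranchExists k r (4 * g + 1) False :=
    ((levelExists_two (k := k) (r := r) (by omega)).node hk0 (by norm_num) (m := 0) (l := 1 + l)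
      (by omega) (by rw [hkr]; push_cast; ring)).mono False.elim
  have hX' : LevelExists k r (-(4 * g)) True := by
    refine ⟨g + 1, by omega, ?_⟩
    have h := hB.node hk0 hB' hD (by linarith) g 1
    rw [show (k : ℝ) * -(4 * g) / (2 * (-(4 * g) - 1)) =
      k - g * (k / (2 * (g * (4 * g + 4) + g + 1) / (4 * g + 4))) -
        (1 : ℕ) * (k / (4 * g + 1)) by
      have h1 : -(4 * (g : ℝ)) - 1 ≠ 0 := by linarith
      have h2 : (g : ℝ) * (4 * g + 4) + g + 1 ≠ 0 := by positivity
      have h3 : (4 * (g : ℝ) + 1) ≠ 0 := by positivity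
      push_cast
      rw [show (g : ℝ) * (4 * g + 4) + g + 1 = (4 * g + 1) * (g + 1) by ring,
        show -(4 * (g : ℝ)) - 1 = -(4 * g + 1) by ring]
      field_simp
      ring]
    exact h.mono (by intro _; left; exact ⟨hg, trivial⟩)
  have h := hX'.step_expand hg hk (by omega) (by omega) (Or.inl (by nlinarith))
  rw [show (g + 1 : ℝ) * -(4 * g) / g + 2 = -(g * ((4 * g + 2) / g)) by field_simp; ring] at h
  exact LevelExists.exists_tree hk0 (LevelExists.zero_of_neg_mul (by positivity)
    (fun _ hY h => h.step_contract_expand hg hk hr (Or.inl hY)) g h)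

end Alternating

/-! ### The case `k = 4 * g + 3`, `r = g + 2`: a four-generation step -/

section ThreeStep

variable {k r g : ℕ}

/-- Four generations with `g + 1`, `g + 1`, `g`, `g + 1` children and no added leaves contract by `g
/ (g + 1)`. Composed with `LevelExists.step_expand` they give a translation by `(6 * g + 4) / g` or
`(6 * g + 4) / (g + 1)`, depending on the order. -/
theorem LevelExists.step_double {X : ℝ} {f : Prop} (h : LevelExists k r X f) (hg : 1 ≤ g)
    (hk : k = 4 * g + 3) (hr : r = g + 2) (hX : g * X + (4 * g + 4) ≤ 0 ∨ 2 ≤ X) :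
    LevelExists k r (g * X / (g + 1) + 4) True := by
  have hk0 : 0 < k := by omega
  have hkr : (k : ℝ) = 4 * g + 3 := by exact_mod_cast hk
  have hg' : (1 : ℝ) ≤ g := by exact_mod_cast hg
  have hXs : X < 0 ∨ 1 < X := by
    rcases hX with hX | hX
    · left; by_contra h0; nlinarith
    · right; linarith
  have hX0 : X ≠ 0 := by rintro rfl; norm_num at hXs
  set a := (2 * g + 1) * X + 2 * g + 2 with ha
  set b := g * X + 2 * g + 2 with hb
  set c := g * X + 3 * g + 3 with hc
  have hsign : (X < 0 ∧ a < 0 ∧ b < 0 ∧ c < 0) ∨ (0 < X ∧ 0 < a ∧ 0 < b ∧ 0 < c) := by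
    rcases hX with hX | hX
    · have : X < 0 := by rcases hXs with h | h <;> nlinarith
      exact Or.inl ⟨this, by rw [ha]; nlinarith, by rw [hb]; nlinarith, by rw [hc]; nlinarith⟩
    · exact Or.inr ⟨by linarith, by positivity, by positivity, by positivity⟩
  have hab : 0 < a / X ∧ 0 < b / a ∧ 0 < c / b := by
    rcases hsign with ⟨h1, h2, h3, h4⟩ | ⟨h1, h2, h3, h4⟩
    · exact ⟨div_pos_of_neg_of_neg h2 h1, div_pos_of_neg_of_neg h3 h2, div_pos_of_neg_of_neg h4 h3⟩
    · exact ⟨div_pos h2 h1, div_pos h3 h2, div_pos h4 h3⟩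
  obtain ⟨ha0, hb0, hc0⟩ : a ≠ 0 ∧ b ≠ 0 ∧ c ≠ 0 := by
    rcases hsign with ⟨h1, h2, h3, h4⟩ | ⟨h1, h2, h3, h4⟩
    · exact ⟨h2.ne, h3.ne, h4.ne⟩
    · exact ⟨h2.ne', h3.ne', h4.ne'⟩
  have hleaf := branchExists_leaf (k := k) (r := r) (by omega)
  have hk' : (0 : ℝ) < k := by exact_mod_cast hk0
  have h1 : BranchExists k r (a / X) True :=
    (h.node hk0 hXs (m := g + 1) (l := 0) (by omega) (by
      rw [hkr, ha]; push_cast; field_simp; ring)).mono (by intro _; right; omega)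
  have h2 : BranchExists k r (k * (b / a)) True := by
    have h2 := (h1.node hk0 hleaf hab.1 hk' (g + 1) 0).branch (by omega)
    rw [show (k : ℝ) - (g + 1 : ℕ) * (k / (a / X)) - (0 : ℕ) * (k / k) = k * (b / a) by
      push_cast
      field_simp
      rw [ha, hb]
      ring] at h2
    exact h2.mono (by intro _; left; left; exact ⟨by omega, trivial⟩)
  have h3 : BranchExists k r (2 * (g + 1) * (c / b)) True := by
    have h3 := (h2.node hk0 hleaf (mul_pos hk' hab.2.1) hk' g 0).branch (by omega)
    rw [show (k : ℝ) - g * (k / (k * (b / a))) - (0 : ℕ) * (k / k) = 2 * (g + 1) * (c / b) by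
      push_cast
      field_simp
      rw [ha, hb, hc, hkr]
      ring] at h3
    exact h3.mono (by intro _; left; left; exact ⟨by omega, trivial⟩)
  refine h3.level hk0 (mul_pos (by positivity) hab.2.2) (n := g + 1) (by omega) (by omega) ?_ ?_
  · intro h1
    apply hc0
    rw [hc]
    field_simp at h1
    linarith
  · push_cast
    field_simp
    rw [hb, hc]
    ring

theorem exists_tree_threeStep (hg : 1 ≤ g) (hk : k = 4 * g + 3) (hr : r = g + 2) :
    ∃ (V : Type) (_ : Fintype V) (T : SimpleGraph V) (_ : DecidableRel T.Adj),
      T.IsTree ∧ graphSpectralRadius T = √(k : ℝ) ∧ T.maxDegree = r := by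
  have hk0 : 0 < k := by omega
  have hkr : (k : ℝ) = 4 * g + 3 := by exact_mod_cast hk
  have hg' : (1 : ℝ) ≤ g := by exact_mod_cast hg
  have hk2 : k = 4 * g + 2 + 1 := by omega
  have h2 := levelExists_two (k := k) (r := r) (by omega)
  have hX₁ : LevelExists k r ((6 * g + 4) / (g + 1)) True := by
    have := h2.step_double hg hk hr (Or.inr le_rfl)
    rwa [show (g * 2 / (g + 1) + 4 : ℝ) = (6 * g + 4) / (g + 1) by field_simp; ring] at this
  have hX₂ : LevelExists k r (g * ((6 * g + 4) / (g + 1))) True := by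
    have h3 := h2.add_mul (c := (6 * g + 4) / g) (fun Y hY h => by
      have h0 : 0 ≤ g * Y / (g + 1 : ℝ) := by positivity
      have := (h.step_double hg hk hr (Or.inr hY)).step_expand hg hk2 (by omega) (by omega)
        (Or.inr (by linarith))
      rw [show (g + 1) * (g * Y / (g + 1) + 4) / g + 2 = Y + (6 * g + 4) / (g : ℝ) by
        field_simp; ring] at this
      exact this.mono fun _ => trivial) (by positivity) (g - 1)
    have := h3.step_double hg hk hr (Or.inr (le_add_of_nonneg_right (by positivity)))
    rwa [show g * (2 + (g - 1 : ℕ) * ((6 * g + 4) / g)) / (g + 1) + 4 =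
      g * ((6 * g + 4) / (g + 1 : ℝ)) by
        rw [Nat.cast_sub hg]; push_cast; field_simp; ring] at this
  have hgt : (1 : ℝ) < (6 * g + 4) / (g + 1) := by
    rw [lt_div_iff₀ (by positivity)]
    linarith
  have hgt' : (1 : ℝ) < g * ((6 * g + 4) / (g + 1)) := by nlinarith
  -- The irregular vertex: one child of level `(6 * g + 4) / (g + 1)` and `g` children of `g` times
  -- that level.
  have hB : BranchExists k r ((6 * g ^ 2 + 9 * g + 4) / (3 * g + 2)) True := by
    have h := (hX₁.branch.node hk0 hX₂.branch (level_pos hk0 (Or.inr hgt))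
      (level_pos hk0 (Or.inr hgt')) 1 g).branch (by omega)
    rw [div_level hk0 (Or.inr hgt), div_level hk0 (Or.inr hgt'), show
      (k : ℝ) - (1 : ℕ) * (2 * ((6 * g + 4) / (g + 1) - 1) / ((6 * g + 4) / (g + 1))) -
        g * (2 * (g * ((6 * g + 4) / (g + 1)) - 1) / (g * ((6 * g + 4) / (g + 1)))) =
      (6 * g ^ 2 + 9 * g + 4) / (3 * g + 2) by
        rw [hkr, show (6 * g + 4 : ℝ) = 2 * (3 * g + 2) by ring]
        push_cast
        field_simp
        ring] at h
    exact h.mono (by intro _; right; omega)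
  have hX' : LevelExists k r (-((6 * g ^ 2 + 8 * g + 4) / g)) True := by
    refine hB.level hk0 (by positivity) (n := g + 1) (by omega) (by omega) ?_ ?_
    · have : (0 : ℝ) < (6 * g ^ 2 + 8 * g + 4) / g := by positivity
      linarith
    · push_cast
      field_simp
      ring
  -- This lands on `-g` times the translation length `(6 * g + 4) / (g + 1)`.
  have h := hX'.step_double hg hk hr (Or.inl (by
    rw [mul_neg, mul_div_cancel₀ _ (by positivity)]
    nlinarith))
  rw [show g * -((6 * g ^ 2 + 8 * g + 4) / g) / (g + 1) + 4 =
    -(g * ((6 * g + 4) / (g + 1 : ℝ))) by field_simp; ring] at h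
  refine LevelExists.exists_tree hk0 (LevelExists.zero_of_neg_mul (by positivity)
    (fun Y hY h => ?_) g h)
  have hY' : (g + 1) * Y + (6 * g + 4) ≤ 0 := by
    rw [le_neg, div_le_iff₀ (by positivity)] at hY
    linarith
  have := (h.step_expand hg hk2 (by omega) (by omega) (Or.inl (by linarith))).step_double hg hk hr
    (Or.inl (by
      rw [mul_add, mul_div_cancel₀ _ (by positivity)]
      linarith))
  rwa [show g * ((g + 1) * Y / g + 2) / (g + 1) + 4 = Y + (6 * g + 4) / (g + 1 : ℝ) by
    field_simp; ring] at this

end ThreeStep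

/-! ### Small cases and assembly -/

theorem exists_star (k : ℕ) (hk : 1 ≤ k) :
    ∃ (V : Type) (_ : Fintype V) (T : SimpleGraph V) (_ : DecidableRel T.Adj),
      T.IsTree ∧ graphSpectralRadius T = √(k : ℝ) ∧ T.maxDegree = k := by
  have hk' : (0 : ℝ) < k := by exact_mod_cast hk
  have h := RootedTreeExists.singleton.attach_many (r := k) hk RootedTreeExists.singleton hk'
    (by omega) k
  rw [div_self hk'.ne', mul_one, sub_self, zero_add] at h
  exact h.exists_tree hk le_rfl (Or.inr rfl)

theorem exists_path_sqrt_three :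
    ∃ (V : Type) (_ : Fintype V) (T : SimpleGraph V) (_ : DecidableRel T.Adj),
      T.IsTree ∧ graphSpectralRadius T = √((3 : ℕ) : ℝ) ∧ T.maxDegree = 2 := by
  -- The path on five vertices, rooted at its centre.
  have h := RootedTreeExists.singleton.attach (k := 3) (r := 2) (by norm_num)
    RootedTreeExists.singleton (by norm_num) (by norm_num)
  have h2 := RootedTreeExists.singleton.attach_many (by norm_num) h (by norm_num) (by norm_num) 2
  norm_num at h2
  exact h2.exists_tree (by norm_num) le_rfl (Or.inr rfl)

theorem exists_tree_of_bounds {k r : ℕ} (hr : 2 ≤ r) (h : k + 4 < 4 * r) (hrk : r ≤ k) :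
    ∃ (V : Type) (_ : Fintype V) (T : SimpleGraph V) (_ : DecidableRel T.Adj),
      T.IsTree ∧ graphSpectralRadius T = √(k : ℝ) ∧ T.maxDegree = r := by
  rcases hrk.eq_or_lt with rfl | hlt
  · exact exists_star r (by omega)
  rcases Nat.lt_or_ge k 4 with hk | hk
  · obtain rfl : k = 3 := by omega
    obtain rfl : r = 2 := by omega
    exact exists_path_sqrt_three
  have hk4 : k = 4 * (k / 4) + k % 4 := (Nat.div_add_mod k 4).symm
  have hl : k % 4 < 4 := Nat.mod_lt _ (by norm_num)
  have hg : 1 ≤ k / 4 := by omega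
  by_cases hrl : k / 4 + k % 4 + 1 ≤ r
  · exact exists_tree_uniform hg hk4 hrl (by omega) hrk
  by_cases hr2 : k % 4 = 3 ∧ r = k / 4 + 2
  · exact exists_tree_threeStep hg (by omega) hr2.2
  -- Here `k % 4` is `2` or `3`, so the subtraction is not truncated.
  · exact exists_tree_alternating (l := k % 4 - 2) hg (by omega) (by omega) (by omega)

theorem mainTheorem2 (k r : ℕ) (hk : 2 ≤ k) (hr : 2 ≤ r) :
    (∃ (V : Type) (_ : Fintype V) (T : SimpleGraph V) (_ : DecidableRel T.Adj),
        T.IsTree ∧ graphSpectralRadius T = Real.sqrt (k : ℝ) ∧ T.maxDegree = r) ↔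
      ((k : ℝ) / 4 + 1 < (r : ℝ) ∧ (r : ℝ) ≤ (k : ℝ)) := by
  constructor
  · rintro ⟨V, _, T, _, hT, hρ, rfl⟩
    exact hT.bounds_of_graphSpectralRadius_eq_sqrt hr hρ
  · rintro ⟨h1, h2⟩
    refine exists_tree_of_bounds hr ?_ (by exact_mod_cast h2)
    have : ((k + 4 : ℕ) : ℝ) < (4 * r : ℕ) := by
      push_cast
      linarith
    exact_mod_cast this
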